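/- Let $(\mathcal C,J)$ and $(\mathcal D,K)$ be small-generated sites (for instance small categories with Grothendieck topologies), and write $\widehat{\mathcal C}_J$, $\widehat{\mathcal D}_K$ for their toposes of sheaves of sets and $l:\mathcal C\to\widehat{\mathcal C}_J$ for the Yoneda embedding followed by sheafification. Let $p:(\mathcal D,K)\to(\mathcal C,J)$ be a continuous comorphism of sites: composition with $p$ sends $J$-sheaves to $K$-sheaves, and for every object $d$ of $\mathcal D$ and every $J$-covering sieve $S$ on $p(d)$ there is a $K$-covering sieve on $d$ whose image under $p$ is contained in $S$. Let $\mathbf{Sh}(p)^*:\widehat{\mathcal D}_K\to\widehat{\mathcal C}_J$ be the left adjoint of $F\mapsto F\circ p^{\mathrm{op}}$. Then $\mathbf{Sh}(p)^*$ is also a left adjoint of $C_p^*=a_K(-\circ p^{\mathrm{op}})$, the inverse image of the geometric morphism $C_p:\widehat{\mathcal D}_K\to\widehat{\mathcal C}_J$ induced by $p$; that is, $\mathbf{Sh}(p)^*\simeq C_{p!}$ is the essential image of $C_p$. Moreover, $\mathbf{Sh}(p)^*$ is a (Street) fibration if and only if, for all objects $c$ of $\mathcal C$ and $d$ of $\mathcal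 D$ and every arrow $f:c\to p(d)$, the functor $\pi_d^f:\mathcal D_{f,d}^{\mathrm{fact}}\to\mathcal C/c$ is $J$-cofinal. Here a functor $q:\mathcal E\to\mathcal B$ is a Street fibration if for every arrow $f:b\to q(e)$ there are an arrow $\hat f:e'\to e$ and an isomorphism $\sigma:q(e')\simeq b$ with $q(\hat f)=f\sigma$ and $\hat f$ cartesian: for every $g:x\to e$ and $h:q(x)\to q(e')$ with $q(\hat f)h=q(g)$ there is a unique $k:x\to e'$ with $q(k)=h$ and $\hat f k=g$. The category $\mathcal D_{f,d}^{\mathrm{fact}}$ has as objects the triples $(d',\,v':p(d')\to c,\,f':d'\to d)$ with $fv'=p(f')$, and as arrows $(d',v',f')\to(d'',v'',f'')$ the arrows $u:d'\to d''$ of $\mathcal D$ with $v''p(u)=v'$ and $f''u=f'$; the functor $\pi_d^f$ sends $(d',v',f')$ to $(p(d'),v')$. A functor $G:\mathcal I\to\mathcal C/c$ is $J$-cofinal if $l(c)$, with the canonical cocone given by the images under $l$ of the arrows $G(i)$ to $c$, is the colimit of the composite $\mathcal I\xrightarrow{G}\mathcal C/c\to\mathcal C\xrightarrow{l}\widehat{\mathcal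 C}_J$. A site $(\mathcal C,J)$ is small-generated if $\mathcal C$ is locally small and there is a small set of objects such that every object of $\mathcal C$ is $J$-covered by arrows whose domains lie in this set. -/

import Mathlib

open CategoryTheory Limits Opposite

universe w v₁ v₂ v₃ u₁ u₂ u₃

noncomputable section

namespace RelTopos

/-! ## Small-generated sites -/

/-- The site `(C, J)` (with `C` locally `w`-small) is small-generated: there is a `w`-small set `P`
of objects such that every object is `J`-covered by arrows whose domains are in `P`. Every small
category with a Grothendieck topology is such a site, see the instance below; so is a
Grothendieck topos with its canonical topology. -/
class IsSmallGenerated {C : Type u₁} [Category.{w} C] (J : GrothendieckTopology C) : Prop where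
  exists_dense : ∃ P : ObjectProperty C, ObjectProperty.Small.{w} P ∧ P.ι.IsCoverDense J

instance {C : Type u₁} [Category.{w} C] [Small.{w} C] (J : GrothendieckTopology C) :
    IsSmallGenerated J where
  exists_dense := by
    refine ⟨⊤, inferInstanceAs (Small.{w} (Subtype _)), ⟨fun U => ?_⟩⟩
    have h : Sieve.coverByImage (ObjectProperty.ι (⊤ : ObjectProperty C)) U = ⊤ := by
      rw [← Sieve.id_mem_iff_eq_top]
      exact ⟨⟨⟨U, trivial⟩, 𝟙 U, 𝟙 U, Category.comp_id _⟩⟩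
    rw [h]
    exact J.top_mem U

section Small

variable {C : Type u₁} [Category.{w} C] (P : ObjectProperty C) [ObjectProperty.Small.{w} P]

lemma essentiallySmall_fullSubcategory : EssentiallySmall.{w} P.FullSubcategory :=
  essentiallySmall_of_small_of_locallySmall _

lemma hasLimitsOfShape_structuredArrow (X : Cᵒᵖ) :
    HasLimitsOfShape (StructuredArrow X P.ι.op) (Type w) := by
  have := essentiallySmall_fullSubcategory P
  exact hasLimitsOfShape_of_essentiallySmall.{w} _ _

end Small

/-- On a small-generated site, presheaves of `w`-small sets have associated sheaves. -/
instance {C : Type u₁} [Category.{w} C] (J : GrothendieckTopology C) [IsSmallGenerated J] :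
    HasSheafify J (Type w) := by
  obtain ⟨P, _, _⟩ := IsSmallGenerated.exists_dense (J := J)
  have := essentiallySmall_fullSubcategory P
  have := hasLimitsOfShape_structuredArrow P
  have : HasSheafify (P.ι.inducedTopology J) (Type w) := hasSheafifyEssentiallySmallSite.{w} _ _
  exact Functor.IsDenseSubsite.hasSheafify_of_isEquivalence (P.ι.inducedTopology J) J P.ι

/-- A continuous functor `p` between small-generated sites has an inverse image functor
`Sh(p)^*`, left adjoint to the composition with `p`. -/
instance {C : Type u₁} [Category.{w} C] {D : Type u₂} [Category.{w} D] (p : D ⥤ C)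
    (K : GrothendieckTopology D) (J : GrothendieckTopology C)
    [IsSmallGenerated K] [IsSmallGenerated J] [p.IsContinuous K J] :
    (p.sheafPushforwardContinuous (Type w) K J).IsRightAdjoint := by
  obtain ⟨P, _, _⟩ := IsSmallGenerated.exists_dense (J := K)
  have := essentiallySmall_fullSubcategory P
  have := hasLimitsOfShape_structuredArrow P
  let F : P.FullSubcategory ⥤ C := P.ι ⋙ p
  let T := P.ι.inducedTopology K
  have : F.IsContinuous T J := Functor.isContinuous_comp P.ι p T K J
  have (X : Cᵒᵖ) : HasColimitsOfShape (CostructuredArrow F.op X) (Type w) :=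
    hasColimitsOfShape_of_essentiallySmall.{w} _ _
  have : (F.sheafPushforwardContinuous (Type w) T J).IsRightAdjoint := inferInstance
  let e : F.sheafPushforwardContinuous (Type w) T J ⋙
      (P.ι.sheafPushforwardContinuous (Type w) T K).inv ≅
      p.sheafPushforwardContinuous (Type w) K J :=
    Functor.isoWhiskerLeft (p.sheafPushforwardContinuous (Type w) K J)
      (P.ι.sheafPushforwardContinuous (Type w) T K).asEquivalence.unitIso.symm
  exact Functor.isRightAdjoint_of_iso e

/-! ## Street fibrations -/

/-- `p : E ⥤ B` is a (Street) fibration: every `f : b ⟶ p e` is, up to an isomorphism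
`σ : p e' ≅ b`, the image of a cartesian arrow `φ : e' ⟶ e`. Here `φ` is cartesian when every
`g : x ⟶ e` with a factorization `p g = p φ ∘ h` factors as `g = φ ∘ k` for a unique `k` with
`p k = h`. -/
def IsStreetFibration {E : Type u₁} [Category.{v₁} E] {B : Type u₂} [Category.{v₂} B]
    (p : E ⥤ B) : Prop :=
  ∀ ⦃b : B⦄ ⦃e : E⦄ (f : b ⟶ p.obj e),
    ∃ (e' : E) (φ : e' ⟶ e) (σ : p.obj e' ≅ b),
      p.map φ = σ.hom ≫ f ∧ p.IsStronglyCartesian (p.map φ) φ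

/-! ## The functors between sheaf toposes -/

section Sheaves

variable {C : Type u₁} [Category.{w} C] {D : Type u₂} [Category.{w} D]
  (p : D ⥤ C) (K : GrothendieckTopology D) (J : GrothendieckTopology C)

/-- The canonical functor `l : C ⥤ Sh(C, J)`, Yoneda embedding followed by sheafification. -/
def canonicalFunctor [IsSmallGenerated J] : C ⥤ Sheaf J (Type w) :=
  yoneda ⋙ presheafToSheaf J (Type w)

/-- The inverse image `C_p^* = a_K(- ∘ p) : Sh(C, J) ⥤ Sh(D, K)` of the geometric morphism `C_p`
induced by a comorphism of sites `p`. -/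
def comorphismInverseImage [IsSmallGenerated K] : Sheaf J (Type w) ⥤ Sheaf K (Type w) :=
  sheafToPresheaf J (Type w) ⋙ (Functor.whiskeringLeft _ _ (Type w)).obj p.op ⋙
    presheafToSheaf K (Type w)

/-- `Sh(p)^* : Sh(D, K) ⥤ Sh(C, J)`, for a continuous functor `p`: the left adjoint of the functor
`F ↦ F ∘ p` on sheaves. -/
abbrev shStar [IsSmallGenerated K] [IsSmallGenerated J] [p.IsContinuous K J] :
    Sheaf K (Type w) ⥤ Sheaf J (Type w) :=
  p.sheafPullback (Type w) K J

end Sheaves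

/-! ## The factorization category -/

section Fact

variable {C : Type u₁} [Category.{v₁} C] {D : Type u₂} [Category.{v₂} D]
  (p : D ⥤ C) {c : C} {d : D} (f : c ⟶ p.obj d)

/-- An object of the factorization category of `f : c ⟶ p d`: an object `d'` with arrows
`v : p d' ⟶ c` and `g : d' ⟶ d` such that `f ∘ v = p g`. -/
structure Fact where
  obj : D
  v : p.obj obj ⟶ c
  g : obj ⟶ d
  w : v ≫ f = p.map g

namespace Fact

variable {p f}

/-- An arrow of the factorization category: an arrow of `D` compatible with `v` and `g`. -/
@[ext]
structure Hom (X Y : Fact p f) where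
  u : X.obj ⟶ Y.obj
  v_eq : p.map u ≫ Y.v = X.v
  g_eq : u ≫ Y.g = X.g

instance : Category (Fact p f) where
  Hom := Hom
  id X := ⟨𝟙 X.obj, by simp, by simp⟩
  comp a b := ⟨a.u ≫ b.u, by simp [a.v_eq, b.v_eq], by simp [a.g_eq, b.g_eq]⟩
  id_comp _ := Hom.ext (Category.id_comp _)
  comp_id _ := Hom.ext (Category.comp_id _)
  assoc _ _ _ := Hom.ext (Category.assoc _ _ _)

end Fact

/-- The projection from the factorization category of `f : c ⟶ p d` to `C/c`, sending
`(d', v, g)` to `v : p d' ⟶ c`. -/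
def factProjection : Fact p f ⥤ Over c where
  obj X := Over.mk X.v
  map a := Over.homMk (p.map a.u) a.v_eq
  map_id X := Over.OverMorphism.ext (p.map_id X.obj)
  map_comp a b := Over.OverMorphism.ext (p.map_comp a.u b.u)

end Fact

/-! ## Cofinality -/

/-- A functor `G : I ⥤ C/c` is `J`-cofinal: `l(c)` is the colimit of the diagram
`I ⥤ C/c ⥤ C ⥤ Sh(C, J)`, with the canonical cocone, whose leg at `i` is the image under `l` of the
arrow `G i` with codomain `c`. -/
def IsCofinal {C : Type u₁} [Category.{w} C] (J : GrothendieckTopology C) [IsSmallGenerated J]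
    {c : C} {I : Type u₃} [Category.{v₃} I] (G : I ⥤ Over c) : Prop :=
  Nonempty (IsColimit ((canonicalFunctor J).mapCocone ((Over.forgetCocone c).whisker G)))

end RelTopos

end

/-! Write `L` for `Sh(p)^*` and `R` for composition with `p`. By continuity `R F` is already a
sheaf, so sheafifying does not change it, and `C_p^*` is `R` up to isomorphism.

An arrow is cartesian for a left adjoint exactly when its unit square is a pullback
(`isStronglyCartesian_iff_isPullback`). A cartesian lift of `f : B ⟶ L E` is therefore the pullback
`Q` of `R f` along the unit of `E`, and the question is whether the transpose `L Q ⟶ B` is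
invertible.

Suppose the `π_d^f` are cofinal. An arrow `Q ⟶ R F` is a family of elements of `F(p d)` indexed by
the pairs in `E(d) × B(p d)` that agree in `(L E)(p d)`; it must extend uniquely to `B ⟶ F`
(`existsUnique_hom`). Cofinality extends it to the elements of `B(c)` lying over the restriction of
a unit element along some `c ⟶ p d`. The universal property of `L` does the rest: an arrow `B ⟶ F`
is a section of the dependent product of `F` along `f`, and an arrow out of `L E` is determined by
its values on `E`.

Conversely, lift the arrow `l(c) ⟶ l(p d) ≅ L (l d)`. Then `Q` is the sheaf associated to the
presheaf of factorizations of `f` (`W_of_isUniversalElement`), because a comorphism lifts covers.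
Hence `F(c) ≅ Hom(L Q, F) ≅ Hom(Q, R F)` is the set of compatible families over the factorization
category, which is cofinality. -/

namespace RelTopos

variable {C : Type u₁} [Category.{w} C] {D : Type u₂} [Category.{w} D]

/-- On a small-generated site, the local isomorphisms of presheaves are the morphisms that are
locally injective and locally surjective. -/
instance wEqualsLocallyBijective (J : GrothendieckTopology C) [IsSmallGenerated J] :
    J.WEqualsLocallyBijective (Type w) := by
  obtain ⟨P, _, _⟩ := IsSmallGenerated.exists_dense (J := J)
  have := essentiallySmall_fullSubcategory P
  have := hasLimitsOfShape_structuredArrow P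
  let T := P.ι.inducedTopology J
  have : T.WEqualsLocallyBijective (Type w) :=
    GrothendieckTopology.WEqualsLocallyBijective.ofEssentiallySmall.{w} T
  exact GrothendieckTopology.WEqualsLocallyBijective.transport J T P.ι
    (Functor.IsDenseSubsite.coverPreserving _ _ _)

/-! ### The two inverse images and their adjunction -/

section Adjunction

variable (J : GrothendieckTopology C) (K : GrothendieckTopology D) (p : D ⥤ C)
  [IsSmallGenerated K] [p.IsContinuous K J]

/-- For a continuous comorphism `p`, the presheaf `F ∘ p` is already a sheaf, so that `C_p^*` is
the composition with `p`. -/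
noncomputable def comorphismInverseImageIso :
    p.sheafPushforwardContinuous (Type w) K J ≅ comorphismInverseImage p K J :=
  Functor.isoWhiskerLeft (p.sheafPushforwardContinuous (Type w) K J)
    (asIso (sheafificationAdjunction K (Type w)).counit).symm

/-- `Sh(p)^*` is left adjoint to `C_p^*`. -/
noncomputable def shStarAdjunction [IsSmallGenerated J] :
    shStar p K J ⊣ comorphismInverseImage p K J :=
  (p.sheafAdjunctionContinuous (Type w) K J).ofNatIsoRight (comorphismInverseImageIso J K p)

end Adjunction

/-! ### Cofinality in terms of elements of sheaves -/

section Canonical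

variable (J : GrothendieckTopology C) [IsSmallGenerated J]

/-- Arrows from `l(c)` to a sheaf `F` are the elements of `F(c)`. -/
noncomputable def canonicalHomEquiv (c : C) (F : Sheaf J (Type w)) :
    ((canonicalFunctor J).obj c ⟶ F) ≃ F.obj.obj (op c) :=
  ((sheafificationAdjunction J (Type w)).homEquiv (yoneda.obj c) F).trans yonedaEquiv

variable {J}

lemma canonicalHomEquiv_map_comp {c c' : C} (t : c' ⟶ c) {F : Sheaf J (Type w)}
    (s : (canonicalFunctor J).obj c ⟶ F) :
    canonicalHomEquiv J c' F ((canonicalFunctor J).map t ≫ s) =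
      F.obj.map t.op (canonicalHomEquiv J c F s) :=
  (congrArg yonedaEquiv ((sheafificationAdjunction J (Type w)).homEquiv_naturality_left
    (yoneda.map t) s)).trans (yonedaEquiv_naturality _ _).symm

lemma canonicalHomEquiv_comp {c : C} {F G : Sheaf J (Type w)}
    (s : (canonicalFunctor J).obj c ⟶ F) (a : F ⟶ G) :
    canonicalHomEquiv J c G (s ≫ a) = a.hom.app (op c) (canonicalHomEquiv J c F s) :=
  congrArg yonedaEquiv ((sheafificationAdjunction J (Type w)).homEquiv_naturality_right s a)

lemma map_canonicalHomEquiv_symm {c c' : C} (t : c' ⟶ c) {F : Sheaf J (Type w)}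
    (x : F.obj.obj (op c)) :
    (canonicalFunctor J).map t ≫ (canonicalHomEquiv J c F).symm x =
      (canonicalHomEquiv J c' F).symm (F.obj.map t.op x) := by
  rw [Equiv.eq_symm_apply, canonicalHomEquiv_map_comp, Equiv.apply_symm_apply]

/-- A functor `G : I ⥤ C/c` is `J`-cofinal if and only if, for every sheaf `F`, the elements of
`F(c)` are the compatible families of elements of `F` at the domains of the `G i`. -/
theorem isCofinal_iff {c : C} {I : Type u₃} [Category.{v₃} I] (G : I ⥤ Over c) :
    IsCofinal J G ↔ ∀ (F : Sheaf J (Type w)) (a : ∀ i, F.obj.obj (op (G.obj i).left)),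
      (∀ ⦃i j : I⦄ (t : i ⟶ j), F.obj.map (G.map t).left.op (a j) = a i) →
        ∃! x : F.obj.obj (op c), ∀ i, F.obj.map (G.obj i).hom.op x = a i := by
  constructor
  · rintro ⟨h⟩ F a ha
    -- A compatible family in `F` is the same as a cocone with apex `F`.
    let s : Cocone ((G ⋙ Over.forget c) ⋙ canonicalFunctor J) :=
      { pt := F
        ι :=
          { app i := (canonicalHomEquiv J _ F).symm (a i)
            naturality i j t :=
              (map_canonicalHomEquiv_symm (G.map t).left (a j)).trans
                ((congrArg _ (ha t)).trans (Category.comp_id _).symm) } }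
    refine ⟨canonicalHomEquiv J c F (h.desc s), fun i => ?_, fun x hx => ?_⟩
    · exact (canonicalHomEquiv_map_comp _ _).symm.trans
        ((Equiv.symm_apply_eq _).1 (h.fac s i).symm).symm
    · exact (Equiv.symm_apply_eq _).1 (h.uniq s ((canonicalHomEquiv J c F).symm x) fun i =>
        (map_canonicalHomEquiv_symm _ x).trans (congrArg _ (hx i)))
  · intro h
    have H (s : Cocone ((G ⋙ Over.forget c) ⋙ canonicalFunctor J)) :=
      h s.pt (fun i => canonicalHomEquiv J _ s.pt (s.ι.app i)) (fun i j t => by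
        rw [← s.w t]
        exact (canonicalHomEquiv_map_comp _ _).symm)
    exact ⟨{
      desc := fun s => (canonicalHomEquiv J c s.pt).symm (H s).choose
      fac := fun s i => (map_canonicalHomEquiv_symm _ _).trans
        ((Equiv.symm_apply_eq _).2 ((H s).choose_spec.1 i))
      uniq := fun s m hm => (Equiv.eq_symm_apply _).2 ((H s).choose_spec.2 _ fun i =>
        (canonicalHomEquiv_map_comp _ _).symm.trans (congrArg _ (hm i))) }⟩

end Canonical

/-! ### Cartesian arrows for a left adjoint -/

/-- An arrow `φ` is cartesian for a left adjoint `L` if and only if the naturality square of the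
unit at `φ` is a pullback. -/
theorem isStronglyCartesian_iff_isPullback {E : Type u₁} [Category.{v₁} E] {B : Type u₂}
    [Category.{v₂} B] {L : E ⥤ B} {R : B ⥤ E} (adj : L ⊣ R) {e' e : E} (φ : e' ⟶ e) :
    L.IsStronglyCartesian (L.map φ) φ ↔
      IsPullback φ (adj.unit.app e') (adj.unit.app e) (R.map (L.map φ)) := by
  -- Transposition matches triangles over `L φ` with squares over `R (L φ)`, and lifts of `g` with
  -- factorizations of its transpose through the unit: the two universal properties coincide.
  have hc {x : E} (g : L.obj x ⟶ L.obj e') (φ' : x ⟶ e) :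
      φ' ≫ adj.unit.app e = adj.homEquiv _ _ g ≫ R.map (L.map φ) ↔ g ≫ L.map φ = L.map φ' := by
    rw [← adj.homEquiv_naturality_right, ← adj.unit_naturality, ← adj.homEquiv_unit,
      EmbeddingLike.apply_eq_iff_eq, eq_comm]
  have hu {x : E} (χ : x ⟶ e') (g : L.obj x ⟶ L.obj e') :
      χ ≫ adj.unit.app e' = adj.homEquiv _ _ g ↔ L.map χ = g := by
    rw [← adj.unit_naturality, ← adj.homEquiv_unit, EmbeddingLike.apply_eq_iff_eq]
  constructor
  · intro h
    have H {x : E} (φ' : x ⟶ e) (z : x ⟶ R.obj (L.obj e'))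
        (hz : φ' ≫ adj.unit.app e = z ≫ R.map (L.map φ)) :
        ∃! χ : x ⟶ e', L.IsHomLift ((adj.homEquiv _ _).symm z) χ ∧ χ ≫ φ = φ' := by
      have hg : (adj.homEquiv _ _).symm z ≫ L.map φ = L.map φ' := by
        rw [← hc, Equiv.apply_symm_apply, hz]
      have : L.IsHomLift ((adj.homEquiv _ _).symm z ≫ L.map φ) φ' := by
        rw [hg]
        infer_instance
      exact h.universal_property' _ φ'
    refine ⟨⟨(adj.unit_naturality φ).symm⟩, ⟨PullbackCone.IsLimit.mk _
      (fun s => (H s.fst s.snd s.condition).choose)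
      (fun s => (H s.fst s.snd s.condition).choose_spec.1.2) (fun s => ?_) fun s m h₁ h₂ => ?_⟩⟩
    · have := (H s.fst s.snd s.condition).choose_spec.1.1
      have h' := (hu _ _).2 (IsHomLift.eq_of_isHomLift L ((adj.homEquiv _ _).symm s.snd)
        (H s.fst s.snd s.condition).choose).symm
      rwa [Equiv.apply_symm_apply] at h'
    · refine (H s.fst s.snd s.condition).choose_spec.2 m ⟨?_, h₁⟩
      rw [← (hu m _).1 (h₂.trans (Equiv.apply_symm_apply _ _).symm)]
      infer_instance
  · intro h
    refine { universal_property' := fun {x} g φ' hφ' => ?_ }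
    have hg : φ' ≫ adj.unit.app e = adj.homEquiv _ _ g ≫ R.map (L.map φ) :=
      (hc _ _).2 (IsHomLift.eq_of_isHomLift L _ _)
    have hl : L.map (h.lift _ _ hg) = g := (hu _ g).1 (h.lift_snd _ _ hg)
    refine ⟨h.lift _ _ hg, ⟨?_, h.lift_fst _ _ _⟩, ?_⟩
    -- The lift depends on `g` through `hg`; it is generalized so that `g` can be substituted.
    · generalize h.lift _ _ hg = χ at hl
      subst hl
      infer_instance
    · rintro χ ⟨hχ, hχ'⟩
      refine h.hom_ext (by simpa using hχ') ?_
      rw [h.lift_snd, hu]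
      exact (IsHomLift.eq_of_isHomLift L _ _).symm

/-- The pullback `φ` of the transpose of an arrow `f : b ⟶ L e` is a cartesian arrow over `f` as
soon as the induced arrow to `b` is an isomorphism. -/
theorem exists_cartesian_of_isPullback {E : Type u₁} [Category.{v₁} E] {B : Type u₂}
    [Category.{v₂} B] {L : E ⥤ B} {R : B ⥤ E} (adj : L ⊣ R) {b : B} {e : E} (f : b ⟶ L.obj e)
    {e' : E} {φ : e' ⟶ e} (a : L.obj e' ⟶ b) [IsIso a]
    (h : IsPullback φ (adj.homEquiv _ _ a) (adj.unit.app e) (R.map f)) :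
    ∃ (e' : E) (φ : e' ⟶ e) (σ : L.obj e' ≅ b),
      L.map φ = σ.hom ≫ f ∧ L.IsStronglyCartesian (L.map φ) φ := by
  have hφ : L.map φ = a ≫ f := by
    apply (adj.homEquiv _ _).injective
    rw [adj.homEquiv_naturality_right, ← h.w, adj.homEquiv_unit, adj.unit_naturality]
  refine ⟨e', φ, asIso a, hφ, ?_⟩
  rw [isStronglyCartesian_iff_isPullback adj]
  -- The unit square at `φ` is the given pullback with the corner `R b` replaced by `R (L e')` along
  -- `R a⁻¹`.
  refine IsPullback.of_iso h (Iso.refl _) (Iso.refl _)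
    (R.mapIso (asIso a).symm) (Iso.refl _) (by simp) ?_ (by simp) ?_
  · simp [adj.homEquiv_unit]
  · simp [hφ]

/-! ### Elements of `L E` coming from `E` -/

section Unit

variable {J : GrothendieckTopology C} {K : GrothendieckTopology D}
  {p : D ⥤ C} [p.IsContinuous K J] {L : Sheaf K (Type w) ⥤ Sheaf J (Type w)}
  (adj : L ⊣ p.sheafPushforwardContinuous (Type w) K J)

/-- The image of an element of `E(d)` in `(L E)(p d)` by the unit of an adjunction whose right
adjoint is the composition with `p`. -/
noncomputable def unitApp {E : Sheaf K (Type w)} {d : D} (e : E.obj.obj (op d)) :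
    (L.obj E).obj.obj (op (p.obj d)) :=
  (adj.unit.app E).hom.app (op d) e

lemma unitApp_map {E : Sheaf K (Type w)} {d d' : D} (k : d' ⟶ d) (e : E.obj.obj (op d)) :
    unitApp adj (E.obj.map k.op e) = (L.obj E).obj.map (p.map k).op (unitApp adj e) :=
  NatTrans.naturality_apply (adj.unit.app E).hom k.op e

lemma unitApp_naturality {E E' : Sheaf K (Type w)} (φ : E' ⟶ E) {d : D} (e : E'.obj.obj (op d)) :
    unitApp adj (φ.hom.app (op d) e) = (L.map φ).hom.app _ (unitApp adj e) :=
  congrArg (fun ψ => ψ.hom.app (op d) e) (adj.unit_naturality φ).symm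

lemma homEquiv_app {E : Sheaf K (Type w)} {F : Sheaf J (Type w)} (a : L.obj E ⟶ F) {d : D}
    (e : E.obj.obj (op d)) :
    (adj.homEquiv E F a).hom.app (op d) e = a.hom.app (op (p.obj d)) (unitApp adj e) :=
  congrArg (fun ψ => ψ.hom.app (op d) e) (adj.homEquiv_unit (f := a))

/-- Arrows out of `L E` are determined by their restriction to the elements of `E`. -/
lemma hom_ext_of_unitApp {E : Sheaf K (Type w)} {F : Sheaf J (Type w)} {a a' : L.obj E ⟶ F}
    (h : ∀ ⦃d : D⦄ (e : E.obj.obj (op d)),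
      a.hom.app _ (unitApp adj e) = a'.hom.app _ (unitApp adj e)) : a = a' := by
  apply (adj.homEquiv _ _).injective
  ext d e
  exact (homEquiv_app adj a e).trans ((h e).trans (homEquiv_app adj a' e).symm)

end Unit

section Pullback

variable {K : GrothendieckTopology D}
  {W X Y Z : Sheaf K (Type w)} {fst : W ⟶ X} {snd : W ⟶ Y} {f : X ⟶ Z} {g : Y ⟶ Z}

lemma isPullback_app (h : IsPullback fst snd f g) (d : D) :
    IsPullback (fst.hom.app (op d)) (snd.hom.app (op d)) (f.hom.app (op d)) (g.hom.app (op d)) :=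
  h.map (sheafToPresheaf K (Type w) ⋙ (evaluation _ _).obj (op d))

end Pullback

/-! ### Dependent products of sheaves -/

/-- A section over `c` of the dependent product along `f : B ⟶ G` of the constant family `F`:
an element `pt` of `G(c)`, and a map to `F` from the pullback of `f` along `pt`. -/
structure DepProd {B G : Cᵒᵖ ⥤ Type w} (f : B ⟶ G) (F : Cᵒᵖ ⥤ Type w) (c : C) where
  pt : G.obj (op c)
  val : ∀ ⦃b : C⦄ (t : b ⟶ c) (z : B.obj (op b)), f.app _ z = G.map t.op pt → F.obj (op b)
  map_val : ∀ ⦃b b' : C⦄ (s : b' ⟶ b) (t : b ⟶ c) (z : B.obj (op b)) (h) (h'),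
    F.map s.op (val t z h) = val (s ≫ t) (B.map s.op z) h'

namespace DepProd

variable {B G : Cᵒᵖ ⥤ Type w} {f : B ⟶ G} {F : Cᵒᵖ ⥤ Type w}

lemma ext {c : C} {m m' : DepProd f F c} (h : m.pt = m'.pt)
    (h' : ∀ ⦃b : C⦄ (t : b ⟶ c) (z : B.obj (op b)) (h₁) (h₂), m.val t z h₁ = m'.val t z h₂) :
    m = m' := by
  obtain ⟨x, v, _⟩ := m
  obtain ⟨x', v', _⟩ := m'
  obtain rfl : x = x' := h
  obtain rfl : v = v' := by
    funext b t z h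
    exact h' t z h h
  rfl

/-- The proof argument of `val` depends on `m`, `t` and `z`, which obstructs rewriting; all three
are changed at once here. -/
lemma val_congr {c : C} {m m' : DepProd f F c} (h : m = m') {b : C} {t t' : b ⟶ c} (ht : t = t')
    {z z' : B.obj (op b)} (hz : z = z') (h₁) (h₂) : m.val t z h₁ = m'.val t' z' h₂ := by
  subst h ht hz
  rfl

variable (f F) in
/-- The presheaf of sections of the dependent product. -/
def presheaf : Cᵒᵖ ⥤ Type (max u₁ w) where
  obj c := DepProd f F c.unop
  map s := TypeCat.ofHom fun m =>
    { pt := G.map s m.pt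
      val b t z h := m.val (t ≫ s.unop) z (by simpa using h)
      map_val b b' s' t z h h' := by
        rw [m.map_val s' _ _ _ (by simpa using h')]
        exact val_congr rfl (Category.assoc _ _ _).symm rfl _ _ }
  map_id c := by
    ext m
    exact DepProd.ext (Functor.map_id_apply G c m.pt) fun b t z h₁ h₂ =>
      val_congr rfl (Category.comp_id t) rfl _ _
  map_comp s s' := by
    ext m
    exact DepProd.ext (Functor.map_comp_apply G s s' m.pt) fun b t z h₁ h₂ =>
      val_congr rfl (Category.assoc t s'.unop s.unop).symm rfl _ _

@[simp]
lemma pt_presheaf_map {c c' : Cᵒᵖ} (s : c ⟶ c') (m : (presheaf f F).obj c) :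
    DepProd.pt ((presheaf f F).map s m) = G.map s m.pt :=
  rfl

/-- Gluing happens twice. The base points glue in `G`; then, for `t` and `z` over the glued point,
the local values at restrictions of `z` match along the sieve pulled back by `t` and glue in `F`. -/
theorem isSheaf (J : GrothendieckTopology C) (hG : Presieve.IsSheaf J G)
    (hF : Presieve.IsSheaf J F) : Presieve.IsSheaf J (presheaf f F) := by
  intro c S hS x hx
  rw [Presieve.compatible_iff_sieveCompatible] at hx
  have key {b b' : C} (k : b ⟶ c) (hk : S k) (s : b' ⟶ b) (hs : S (s ≫ k)) :
      (presheaf f F).map s.op (x k hk) = x (s ≫ k) hs := (hx k s hk).symm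
  let y : Presieve.FamilyOfElements G S.arrows := fun b k hk => (x k hk).pt
  have hy : y.Compatible := by
    rw [Presieve.compatible_iff_sieveCompatible]
    intro b b' k s hk
    exact (congrArg DepProd.pt (key k hk s _)).symm
  obtain ⟨pt, hpt, hpt'⟩ := hG S hS y hy
  have hz {b b' : C} (t : b ⟶ c) (z : B.obj (op b)) (h : f.app _ z = G.map t.op pt)
      (s : b' ⟶ b) (hs : S (s ≫ t)) :
      f.app _ (B.map s.op z) = G.map (𝟙 b' : b' ⟶ b').op (x (s ≫ t) hs).pt := by
    rw [NatTrans.naturality_apply, h]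
    simpa using hpt (s ≫ t) hs
  have hx' {b : C} {k k' : b ⟶ c} (e : k = k') (hk : S k) (hk' : S k') : x k hk = x k' hk' := by
    subst e
    rfl
  let v {b : C} (t : b ⟶ c) (z : B.obj (op b)) (h : f.app _ z = G.map t.op pt) :
      Presieve.FamilyOfElements F (S.pullback t).arrows := fun b' s hs =>
    (x (s ≫ t) hs).val (𝟙 b') (B.map s.op z) (hz t z h s hs)
  have hv {b : C} (t : b ⟶ c) (z : B.obj (op b)) (h : f.app _ z = G.map t.op pt) :
      (v t z h).Compatible := by
    rw [Presieve.compatible_iff_sieveCompatible]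
    intro b' b'' s r hs
    have hrs : S (r ≫ s ≫ t) := S.downward_closed hs r
    have h₁ : f.app _ (B.map r.op (B.map s.op z)) =
        G.map (r ≫ 𝟙 b').op (x (s ≫ t) hs).pt := by
      rw [NatTrans.naturality_apply, hz t z h s hs]
      simp
    refine Eq.trans ?_ ((x (s ≫ t) hs).map_val r _ _ (hz t z h s hs) h₁).symm
    exact (val_congr (m' := (presheaf f F).map r.op (x (s ≫ t) hs))
      ((hx' (Category.assoc _ _ _) _ _).trans (key _ hs r hrs).symm) rfl
      (Functor.map_comp_apply B s.op r.op z) _ (by simpa using h₁)).trans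
      (val_congr rfl ((Category.id_comp r).trans (Category.comp_id r).symm) rfl _ _)
  choose w hw hw' using fun (b : C) (t : b ⟶ c) (z : B.obj (op b))
    (h : f.app _ z = G.map t.op pt) => hF _ (J.pullback_stable t hS) (v t z h) (hv t z h)
  let m : DepProd f F c :=
    { pt := pt
      val := w
      map_val b b' s t z h h' := by
        refine hw' _ (s ≫ t) (B.map s.op z) h' _ fun b'' r hr => ?_
        rw [← Functor.map_comp_apply, ← op_comp, hw _ t z h (r ≫ s) (by simpa using hr)]
        exact val_congr (hx' (Category.assoc _ _ _) _ _) rfl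
          (Functor.map_comp_apply B s.op r.op z) _ _ }
  refine ⟨m, fun b k hk => DepProd.ext (hpt k hk) fun b' t z h₁ h₂ => ?_,
    fun m' hm' => DepProd.ext (hpt' _ fun b k hk => congrArg DepProd.pt (hm' k hk))
      fun b t z h₁ h₂ => hw' _ t z h₂ _ fun b' s hs => ?_⟩
  -- As `k` is in `S`, the sieve pulled back along `t ≫ k` contains the identity, where the
  -- amalgamation can be read off.
  · have hk' : S (𝟙 b' ≫ t ≫ k) := S.downward_closed (S.downward_closed hk t) _
    have h₃ := hw _ (t ≫ k) z (by simpa using! h₁) (𝟙 b') hk'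
    rw [op_id, Functor.map_id_apply] at h₃
    refine Eq.trans h₃ ?_
    exact (val_congr (m' := (presheaf f F).map t.op (x k hk))
      ((hx' (Category.id_comp _) _ _).trans (key _ hk t (S.downward_closed hk t)).symm) rfl
      (Functor.map_id_apply B _ z) _ (by simpa using h₂)).trans
      (val_congr rfl (Category.id_comp t) rfl _ _)
  · have h₃ : f.app _ (B.map s.op z) = G.map (s ≫ t).op m'.pt := by
      rw [NatTrans.naturality_apply, h₁]
      simp
    refine (m'.map_val s t z h₁ h₃).trans ?_
    exact (val_congr rfl (Category.id_comp _).symm rfl _ (by simpa using h₃)).trans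
      (val_congr (m := (presheaf f F).map (s ≫ t).op m') (hm' (s ≫ t) hs) rfl rfl
        (by simpa using h₃) _)

/-- On a small-generated site, a section of the dependent product is determined by its values on
a small dense set of objects. -/
theorem small (J : GrothendieckTopology C) [IsSmallGenerated J] (hF : Presieve.IsSheaf J F)
    (c : C) : Small.{w} (DepProd f F c) := by
  obtain ⟨P, _, _⟩ := IsSmallGenerated.exists_dense (J := J)
  have : Small.{w} (Subtype P) := inferInstance
  -- Each value is recorded as a set with at most one element, so that the target does not depend on
  -- the proof argument of `val`, hence not on `m.pt`.
  let Φ (m : DepProd f F c) : G.obj (op c) × (∀ (b : Subtype P) (t : b.1 ⟶ c)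
      (_ : B.obj (op b.1)), Set (F.obj (op b.1))) :=
    ⟨m.pt, fun _ t z => {y | ∃ h, m.val t z h = y}⟩
  refine small_of_injective (f := Φ) fun m m' h => ?_
  have hpt : m.pt = m'.pt := congrArg Prod.fst h
  refine DepProd.ext hpt fun b t z h₁ h₂ => ?_
  refine ((hF _ (P.ι.is_cover_of_isCoverDense J b)).isSeparatedFor).ext ?_
  rintro b' _ ⟨⟨b₀, l, s, rfl⟩⟩
  have h₁' : f.app _ (B.map s.op z) = G.map (s ≫ t).op m.pt := by
    rw [NatTrans.naturality_apply, h₁]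
    simp
  rw [op_comp, Functor.map_comp_apply, Functor.map_comp_apply, m.map_val s t z h₁ h₁',
    m'.map_val s t z h₂ (by rwa [hpt] at h₁')]
  congr 1
  have h₃ := congrFun (congrFun (congrFun (congrArg Prod.snd h) ⟨b₀.obj, b₀.property⟩) (s ≫ t))
    (B.map s.op z)
  have h₄ : m.val (s ≫ t) (B.map s.op z) h₁' ∈ {y | ∃ h, m'.val (s ≫ t) (B.map s.op z) h = y} := by
    exact h₃.subset ⟨h₁', rfl⟩
  obtain ⟨_, h₅⟩ := h₄
  exact h₅.symm

end DepProd

section Sheaf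

variable {J : GrothendieckTopology C} [IsSmallGenerated J] {B G : Sheaf J (Type w)} (f : B ⟶ G)
  (F : Sheaf J (Type w))

instance (c : Cᵒᵖ) : Small.{w} ((DepProd.presheaf f.hom F.obj).obj c) :=
  DepProd.small J ((isSheaf_iff_isSheaf_of_type J F.obj).1 F.property) c.unop

/-- The sheaf of sections of the dependent product. -/
noncomputable def depProdSheaf : Sheaf J (Type w) where
  obj := FunctorToTypes.shrink.{w} (DepProd.presheaf f.hom F.obj)
  property := by
    rw [isSheaf_iff_isSheaf_of_type]
    refine (Presieve.isSheaf_iff_of_nat_equiv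
      (fun c => equivShrink.{w} ((DepProd.presheaf f.hom F.obj).obj (op c))) fun c c' s m => ?_).1
      (DepProd.isSheaf J ((isSheaf_iff_isSheaf_of_type J G.obj).1 G.property)
        ((isSheaf_iff_isSheaf_of_type J F.obj).1 F.property))
    exact congrArg _ (congrArg _
      ((equivShrink.{w} ((DepProd.presheaf f.hom F.obj).obj (op c'))).symm_apply_apply m).symm)

/-- The elements of the sheaf of sections of the dependent product. -/
noncomputable def depProdEquiv (c : C) :
    DepProd f.hom F.obj c ≃ (depProdSheaf f F).obj.obj (op c) :=
  equivShrink.{w} ((DepProd.presheaf f.hom F.obj).obj (op c))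

variable {f F}

lemma depProdEquiv_map {c c' : C} (s : c' ⟶ c) (m : DepProd f.hom F.obj c) :
    depProdEquiv f F c' ((DepProd.presheaf f.hom F.obj).map s.op m) =
      (depProdSheaf f F).obj.map s.op (depProdEquiv f F c m) :=
  congrArg (equivShrink.{w} ((DepProd.presheaf f.hom F.obj).obj (op c')))
    (congrArg ((DepProd.presheaf f.hom F.obj).map s.op)
    ((equivShrink.{w} ((DepProd.presheaf f.hom F.obj).obj (op c))).symm_apply_apply m).symm)

lemma depProdEquiv_symm_map {c c' : C} (s : c' ⟶ c) (x : (depProdSheaf f F).obj.obj (op c)) :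
    (depProdEquiv f F c').symm ((depProdSheaf f F).obj.map s.op x) =
      (DepProd.presheaf f.hom F.obj).map s.op ((depProdEquiv f F c).symm x) :=
  (Equiv.symm_apply_eq _).2 ((congrArg _ (Equiv.apply_symm_apply _ x).symm).trans
    (depProdEquiv_map s _).symm)

variable (f F)

/-- The projection of the dependent product to its base. -/
noncomputable def depProdπ : depProdSheaf f F ⟶ G where
  hom :=
    { app c := TypeCat.ofHom fun x => ((depProdEquiv f F c.unop).symm x).pt
      naturality c c' s := by
        ext x
        exact congrArg DepProd.pt (depProdEquiv_symm_map s.unop x) }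

/-- The section of the dependent product given by an arrow `B ⟶ F`. -/
noncomputable def depProdSection (a : B ⟶ F) : G ⟶ depProdSheaf f F where
  hom :=
    { app c := TypeCat.ofHom fun x => depProdEquiv f F c.unop
        { pt := x
          val := fun _ _ z _ => a.hom.app _ z
          map_val := fun _ _ s _ z _ _ => (NatTrans.naturality_apply a.hom s.op z).symm }
      naturality c c' s := by
        ext x
        exact depProdEquiv_map (f := f) (F := F) s.unop
          { pt := x
            val := fun _ _ z _ => a.hom.app _ z
            map_val := fun _ _ s _ z _ _ => (NatTrans.naturality_apply a.hom s.op z).symm } }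

/-- The section attached to `a`, taken at the point `f z` and evaluated at `𝟙` and `z`, returns `a
z`. -/
lemma depProdSection_injective : Function.Injective (depProdSection f F) := by
  intro a a' h
  ext c z
  have h₁ := (depProdEquiv f F _).injective
    (congrArg (fun ψ : G ⟶ depProdSheaf f F => ψ.hom.app c (f.hom.app c z)) h)
  exact DepProd.val_congr h₁ (t := 𝟙 c.unop) rfl (z := z) rfl
    (Functor.map_id_apply G.obj c _).symm (Functor.map_id_apply G.obj c _).symm

variable {f F}

lemma pt_section {s : G ⟶ depProdSheaf f F} (hs : s ≫ depProdπ f F = 𝟙 G) {c : C}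
    (x : G.obj.obj (op c)) : ((depProdEquiv f F c).symm (s.hom.app _ x)).pt = x :=
  congrArg (fun ψ => ψ.hom.app (op c) x) hs

lemma pt_section_id {s : G ⟶ depProdSheaf f F} (hs : s ≫ depProdπ f F = 𝟙 G) {c : C}
    (z : B.obj.obj (op c)) : f.hom.app _ z =
      G.obj.map (𝟙 c : c ⟶ c).op ((depProdEquiv f F c).symm (s.hom.app _ (f.hom.app _ z))).pt := by
  rw [pt_section hs, op_id, Functor.map_id_apply]

/-- The arrow `B ⟶ F` given by a section of the dependent product. -/
noncomputable def homOfSection (s : G ⟶ depProdSheaf f F) (hs : s ≫ depProdπ f F = 𝟙 G) :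
    B ⟶ F where
  hom :=
    { app c := TypeCat.ofHom fun z => ((depProdEquiv f F c.unop).symm
        (s.hom.app _ (f.hom.app _ z))).val (𝟙 c.unop) z (pt_section_id hs z)
      naturality c c' k := by
        ext z
        have h₁ : (depProdEquiv f F c'.unop).symm (s.hom.app _ (f.hom.app _ (B.obj.map k z))) =
            (DepProd.presheaf f.hom F.obj).map k
              ((depProdEquiv f F c.unop).symm (s.hom.app _ (f.hom.app _ z))) := by
          rw [NatTrans.naturality_apply, NatTrans.naturality_apply]
          exact depProdEquiv_symm_map k.unop _
        have h₂ : f.hom.app _ (B.obj.map k z) = G.obj.map k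
            ((depProdEquiv f F c.unop).symm (s.hom.app _ (f.hom.app _ z))).pt := by
          rw [pt_section hs, NatTrans.naturality_apply]
        refine Eq.trans ?_ (DepProd.map_val _ k.unop _ _ (pt_section_id hs z)
          (by rw [Category.comp_id]; exact h₂)).symm
        refine (DepProd.val_congr h₁ rfl rfl _ ?_).trans (DepProd.val_congr rfl
          ((Category.id_comp k.unop).trans (Category.comp_id k.unop).symm) rfl
          (by rw [Category.id_comp]; exact h₂) _)
        rw [op_id, Functor.map_id_apply]
        exact h₂ }

lemma homOfSection_app (s : G ⟶ depProdSheaf f F) (hs : s ≫ depProdπ f F = 𝟙 G) {c : C}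
    (z : B.obj.obj (op c)) : (homOfSection s hs).hom.app (op c) z =
      ((depProdEquiv f F c).symm (s.hom.app _ (f.hom.app _ z))).val (𝟙 c) z
        (pt_section_id hs z) :=
  rfl

end Sheaf

/-! ### Cofinality implies fibration -/

section Extension

variable {J : GrothendieckTopology C} {K : GrothendieckTopology D}
  {p : D ⥤ C} [p.IsContinuous K J] {L : Sheaf K (Type w) ⥤ Sheaf J (Type w)}
  (adj : L ⊣ p.sheafPushforwardContinuous (Type w) K J)

/-- Since `v ≫ t = p g`, restricting along `v` turns the `t`-restriction of a unit element into a
unit element. A family indexed by agreeing pairs can thus be evaluated at every factorization of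
`t`. -/
lemma unitApp_eq_of_fact {E : Sheaf K (Type w)} {B : Sheaf J (Type w)} (f : B ⟶ L.obj E) {c : C}
    {d : D} {t : c ⟶ p.obj d} {e : E.obj.obj (op d)} {z : B.obj.obj (op c)}
    (h : f.hom.app _ z = (L.obj E).obj.map t.op (unitApp adj e)) (X : Fact p t) :
    f.hom.app _ (B.obj.map X.v.op z) = unitApp adj (E.obj.map X.g.op e) := by
  rw [NatTrans.naturality_apply, h, unitApp_map, ← X.w]
  simp

variable [IsSmallGenerated J]
  (hp : ∀ (c : C) (d : D) (f : c ⟶ p.obj d), IsCofinal J (factProjection p f))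
include adj hp

/-- If the functors `π_d^f` are `J`-cofinal, an arrow `B ⟶ F` over an arrow `f : B ⟶ L E` amounts
to a compatible family of elements of `F(p d)` indexed by the elements of the pullback of `R f` and
the unit of `E`. -/
theorem existsUnique_hom {E : Sheaf K (Type w)} {B F : Sheaf J (Type w)} (f : B ⟶ L.obj E)
    (α : ∀ ⦃d : D⦄ (e : E.obj.obj (op d)) (z : B.obj.obj (op (p.obj d))),
      f.hom.app _ z = unitApp adj e → F.obj.obj (op (p.obj d)))
    (hα : ∀ ⦃d d' : D⦄ (k : d' ⟶ d) (e : E.obj.obj (op d)) (z : B.obj.obj (op (p.obj d))) (h) (h'),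
      F.obj.map (p.map k).op (α e z h) =
        α (E.obj.map k.op e) (B.obj.map (p.map k).op z) h') :
    ∃! a : B ⟶ F, ∀ ⦃d : D⦄ (e : E.obj.obj (op d)) (z : B.obj.obj (op (p.obj d))) (h),
      a.hom.app _ z = α e z h := by
  have hα' {d : D} {e e' : E.obj.obj (op d)} {z z' : B.obj.obj (op (p.obj d))} (he : e = e')
      (hz : z = z') (h) (h') : α e z h = α e' z' h' := by
    subst he hz
    rfl
  have H {c : C} {d : D} (t : c ⟶ p.obj d) (e : E.obj.obj (op d)) (z : B.obj.obj (op c))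
      (h : f.hom.app _ z = (L.obj E).obj.map t.op (unitApp adj e)) :
      ∃! y : F.obj.obj (op c), ∀ X : Fact p t, F.obj.map X.v.op y =
        α (E.obj.map X.g.op e) (B.obj.map X.v.op z) (unitApp_eq_of_fact adj f h X) := by
    refine (isCofinal_iff _).1 (hp c d t) F (fun X =>
      α (E.obj.map X.g.op e) (B.obj.map X.v.op z) (unitApp_eq_of_fact adj f h X))
      fun X Y u => ?_
    have h₁ : E.obj.map u.u.op (E.obj.map Y.g.op e) = E.obj.map X.g.op e := by
      rw [← u.g_eq, op_comp, Functor.map_comp_apply]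
    have h₂ : B.obj.map (p.map u.u).op (B.obj.map Y.v.op z) = B.obj.map X.v.op z := by
      rw [← u.v_eq, op_comp, Functor.map_comp_apply]
    refine (hα u.u _ _ _ ?_).trans (hα' h₁ h₂ _ _)
    rw [h₁, h₂]
    exact unitApp_eq_of_fact adj f h X
  choose y hy hy' using @H
  -- The values `y` assemble into a point of the dependent product over the unit image of `e`; their
  -- uniqueness gives compatibility with restriction, since factorizations of `s ≫ t` yield
  -- factorizations of `t`.
  let m {d : D} (e : E.obj.obj (op d)) : DepProd f.hom F.obj (p.obj d) :=
    { pt := unitApp adj e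
      val c t z h := y t e z h
      map_val c c' s t z h h' := by
        refine hy' _ _ _ _ _ fun X => ?_
        rw [← Functor.map_comp_apply, ← op_comp]
        refine (hy t e z h ⟨X.obj, X.v ≫ s, X.g, by rw [Category.assoc, X.w]⟩).trans
          (hα' rfl ?_ _ _)
        simp }
  let τ : E ⟶ (p.sheafPushforwardContinuous (Type w) K J).obj (depProdSheaf f F) :=
    { hom :=
        { app d := TypeCat.ofHom fun e => depProdEquiv f F _ (m (d := d.unop) e)
          naturality d d' k := by
            ext e
            refine Eq.trans ?_ (depProdEquiv_map (p.map k.unop) (m (d := d.unop) e))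
            refine congrArg (depProdEquiv f F _) ?_
            refine DepProd.ext (unitApp_map adj k.unop e) fun c t z h₁ h₂ => ?_
            refine (hy' _ _ _ _ _ fun X => ?_).symm
            have h₃ : f.hom.app _ z = (L.obj E).obj.map (t ≫ p.map k.unop).op
                (unitApp adj (d := d.unop) e) := by
              rw [op_comp, Functor.map_comp_apply]
              exact h₂
            refine (hy (t ≫ p.map k.unop) e z h₃ ⟨X.obj, X.v, X.g ≫ k.unop, by
              rw [p.map_comp, ← X.w, Category.assoc]⟩).trans (hα' ?_ rfl _ _)
            rw [op_comp, Functor.map_comp_apply]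
            rfl } }
  -- Transposing extends `e ↦ m e` to all of `L E`. It is a section of the projection because this
  -- can be tested on unit elements.
  let τ' : L.obj E ⟶ depProdSheaf f F := (adj.homEquiv _ _).symm τ
  have hτ' {d : D} (e : E.obj.obj (op d)) :
      (depProdEquiv f F _).symm (τ'.hom.app _ (unitApp adj e)) = m e := by
    rw [← homEquiv_app, Equiv.apply_symm_apply]
    exact Equiv.symm_apply_apply _ _
  have hπ : τ' ≫ depProdπ f F = 𝟙 _ :=
    hom_ext_of_unitApp adj fun d e => congrArg DepProd.pt (hτ' e)
  have hτ ⦃d : D⦄ (e : E.obj.obj (op d)) (z : B.obj.obj (op (p.obj d)))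
      (h : f.hom.app _ z = unitApp adj e) : (homOfSection τ' hπ).hom.app _ z = α e z h := by
    have h₁ : f.hom.app _ z = (L.obj E).obj.map (𝟙 (p.obj d) : p.obj d ⟶ p.obj d).op
        (unitApp adj e) := by
      rw [h, op_id, Functor.map_id_apply]
    rw [homOfSection_app]
    refine (DepProd.val_congr (m' := m e) ?_ rfl rfl _ h₁).trans ?_
    · rw [h, hτ']
    -- The trivial factorization of `𝟙 (p d)` identifies `y` with `α`.
    · have h₂ := hy (𝟙 (p.obj d)) e z h₁ ⟨d, 𝟙 _, 𝟙 _, by simp⟩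
      exact (Functor.map_id_apply F.obj (op (p.obj d)) _).symm.trans (h₂.trans
        (hα' (Functor.map_id_apply E.obj (op d) e)
          (Functor.map_id_apply B.obj (op (p.obj d)) z) _ _))
  refine ⟨homOfSection τ' hπ, hτ, fun a ha => ?_⟩
  · have huniq (a : B ⟶ F) (ha : ∀ ⦃d : D⦄ (e : E.obj.obj (op d)) (z : B.obj.obj (op (p.obj d)))
        (h), a.hom.app _ z = α e z h) {c : C} {d : D} (t : c ⟶ p.obj d) (e : E.obj.obj (op d))
        (z : B.obj.obj (op c))
        (h : f.hom.app _ z = (L.obj E).obj.map t.op (unitApp adj e)) :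
        a.hom.app _ z = y t e z h :=
      hy' _ _ _ _ _ fun X => by
        rw [← NatTrans.naturality_apply]
        exact ha _ _ _
    apply depProdSection_injective f F
    refine hom_ext_of_unitApp adj fun d e => congrArg (depProdEquiv f F _) ?_
    refine DepProd.ext rfl fun c t z h₁ h₂ => ?_
    exact (huniq a ha t e z h₁).trans (huniq _ hτ t e z h₁).symm

/-- If the functors `π_d^f` are `J`-cofinal, the left adjoint `L` of the composition with `p` is a
Street fibration. -/
theorem isStreetFibration_of_isCofinal : IsStreetFibration L := by
  intro B E f
  let R := p.sheafPushforwardContinuous (Type w) K J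
  have hpb := IsPullback.of_hasPullback (adj.unit.app E) (R.map f)
  let fst : pullback (adj.unit.app E) (R.map f) ⟶ E := pullback.fst _ _
  let snd : pullback (adj.unit.app E) (R.map f) ⟶ R.obj B := pullback.snd _ _
  let a := (adj.homEquiv _ _).symm snd
  have ha : adj.homEquiv _ _ a = snd := Equiv.apply_symm_apply _ _
  have : IsIso a := by
    -- By Yoneda, every `y : L Q ⟶ F` must factor uniquely through `a`. The elements of `Q` are
    -- agreeing pairs `(e, z)`, so the transpose of `y` is a family as in `existsUnique_hom`.
    apply isIso_of_coyoneda_map_bijective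
    intro F
    rw [Function.bijective_iff_existsUnique]
    intro y
    have hex {d : D} (e : E.obj.obj (op d)) (z : B.obj.obj (op (p.obj d)))
        (h : f.hom.app _ z = unitApp adj e) :=
      Types.exists_of_isPullback (isPullback_app hpb d) e z h.symm
    choose lift hfst hsnd using @hex
    have hmem {d : D} (x) : f.hom.app _ (snd.hom.app (op d) x) =
        unitApp adj (fst.hom.app (op d) x) :=
      (ConcreteCategory.congr_hom (isPullback_app hpb d).w x).symm
    have hext {d : D} (x x') (h₁ : fst.hom.app (op d) x = fst.hom.app (op d) x')
        (h₂ : snd.hom.app (op d) x = snd.hom.app (op d) x') : x = x' :=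
      Types.ext_of_isPullback (isPullback_app hpb d) h₁ h₂
    have key := existsUnique_hom adj hp f
      (fun d e z h => (adj.homEquiv _ _ y).hom.app (op d) (lift e z h)) (fun d d' k e z h h' => by
        refine (NatTrans.naturality_apply (adj.homEquiv _ _ y).hom k.op (lift e z h)).symm.trans ?_
        refine congrArg _ (hext _ _ ?_ ?_)
        · rw [NatTrans.naturality_apply]
          exact (congrArg _ (hfst e z h)).trans (hfst _ _ _).symm
        · rw [NatTrans.naturality_apply]
          exact (congrArg _ (hsnd e z h)).trans (hsnd _ _ _).symm)
    have hiff (b : B ⟶ F) : a ≫ b = y ↔ ∀ ⦃d : D⦄ (e : E.obj.obj (op d))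
        (z : B.obj.obj (op (p.obj d))) (h), b.hom.app _ z =
          (adj.homEquiv _ _ y).hom.app (op d) (lift e z h) := by
      have hab : adj.homEquiv _ _ (a ≫ b) = snd ≫ R.map b := by
        rw [adj.homEquiv_naturality_right, ha]
      rw [← (adj.homEquiv _ _).apply_eq_iff_eq, hab]
      constructor
      · intro h d e z hz
        rw [← h]
        exact congrArg (b.hom.app _) (hsnd e z hz).symm
      · intro h
        ext d x
        refine (h _ _ (hmem (d := d.unop) x)).trans (congrArg _ ?_)
        exact hext (d := d.unop) _ _ (hfst _ _ _) (hsnd _ _ _)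
    simpa only [hiff] using key
  refine exists_cartesian_of_isPullback adj f a (φ := fst) ?_
  rw [ha]
  exact hpb

end Extension

/-! ### Universal elements and local isomorphisms -/

section Universal

variable {J : GrothendieckTopology C}

/-- An element `x` of `F(c)`, for a sheaf `F`, is universal if it exhibits `F` as the sheaf
associated to the presheaf represented by `c`. -/
def IsUniversalElement {F : Sheaf J (Type w)} {c : C} (x : F.obj.obj (op c)) : Prop :=
  ∀ G : Sheaf J (Type w), Function.Bijective fun a : F ⟶ G => a.hom.app (op c) x

lemma isUniversalElement_canonicalHomEquiv [IsSmallGenerated J] {F : Sheaf J (Type w)} {c : C}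
    (s : (canonicalFunctor J).obj c ⟶ F) [IsIso s] :
    IsUniversalElement (canonicalHomEquiv J c F s) := by
  intro G
  have h : (fun a : F ⟶ G => a.hom.app (op c) (canonicalHomEquiv J c F s)) =
      fun a => canonicalHomEquiv J c G (s ≫ a) :=
    funext fun a => (canonicalHomEquiv_comp s a).symm
  rw [h]
  exact (canonicalHomEquiv J c G).bijective.comp
    ((isIso_iff_coyoneda_map_bijective s).1 inferInstance G)

namespace IsUniversalElement

variable {F : Sheaf J (Type w)} {c : C} {x : F.obj.obj (op c)}

/-- Arrows to a sheaf `G`, from `F` by universality and from the representable presheaf by Yoneda,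
both amount to elements of `G(c)`. -/
lemma W (hx : IsUniversalElement x) : J.W (yonedaEquiv.symm x) := by
  intro G hG
  have h : (fun a : F.obj ⟶ G => yonedaEquiv.symm x ≫ a) =
      fun a => yonedaEquiv.symm (a.app (op c) x) := by
    funext a
    apply yonedaEquiv.injective
    rw [Equiv.apply_symm_apply, yonedaEquiv_comp, Equiv.apply_symm_apply]
  rw [h]
  exact yonedaEquiv.symm.bijective.comp
    ((hx ⟨G, hG⟩).comp ((fullyFaithfulSheafToPresheaf J (Type w)).homEquiv
      (X := F) (Y := ⟨G, hG⟩)).symm.bijective)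

variable [IsSmallGenerated J]

/-- Local surjectivity of the local isomorphism `yoneda c ⟶ F`; the next lemma is its local
injectivity. -/
lemma exists_map_eq_mem (hx : IsUniversalElement x) {b : C} (y : F.obj.obj (op b)) :
    ∃ S ∈ J b, ∀ ⦃b' : C⦄ (s : b' ⟶ b), S s →
      ∃ t : b' ⟶ c, F.obj.map t.op x = F.obj.map s.op y := by
  have := hx.W.isLocallySurjective
  refine ⟨_, Presheaf.imageSieve_mem J (yonedaEquiv.symm x) (U := op b) y, ?_⟩
  rintro b' s ⟨t, ht⟩
  exact ⟨t, ht⟩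

lemma exists_comp_eq_mem (hx : IsUniversalElement x) {b : C} (t t' : b ⟶ c)
    (h : F.obj.map t.op x = F.obj.map t'.op x) :
    ∃ S ∈ J b, ∀ ⦃b' : C⦄ (s : b' ⟶ b), S s → s ≫ t = s ≫ t' := by
  have := hx.W.isLocallyInjective
  refine ⟨_, Presheaf.equalizerSieve_mem J (yonedaEquiv.symm x) (X := op b) t t' h, ?_⟩
  intro b' s hs
  exact hs

end IsUniversalElement

end Universal

/-! ### Fibration implies cofinality -/

section Cofinal

variable {J : GrothendieckTopology C} {K : GrothendieckTopology D}
  {p : D ⥤ C} [p.IsContinuous K J] {L : Sheaf K (Type w) ⥤ Sheaf J (Type w)}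
  (adj : L ⊣ p.sheafPushforwardContinuous (Type w) K J)

/-- The unit of the adjunction preserves universal elements: `L (l d)` is `l (p d)`. -/
lemma IsUniversalElement.unitApp {E : Sheaf K (Type w)} {d : D} {e : E.obj.obj (op d)}
    (he : IsUniversalElement e) : IsUniversalElement (unitApp adj e) := by
  intro G
  have h : (fun a : L.obj E ⟶ G => a.hom.app _ (RelTopos.unitApp adj e)) =
      fun a => (adj.homEquiv _ _ a).hom.app (op d) e :=
    funext fun a => (homEquiv_app adj a e).symm
  rw [h]
  exact (he _).comp (adj.homEquiv _ _).bijective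

variable (p) in
/-- The presheaf on `D` whose category of elements is the factorization category of `f`. -/
def factPresheaf {c : C} {d : D} (f : c ⟶ p.obj d) : Dᵒᵖ ⥤ Type w where
  obj d' := { x : (p.obj d'.unop ⟶ c) × (d'.unop ⟶ d) // x.1 ≫ f = p.map x.2 }
  map k := TypeCat.ofHom fun x => ⟨⟨p.map k.unop ≫ x.1.1, k.unop ≫ x.1.2⟩, by simp [x.2]⟩
  map_id d' := by
    ext x
    · change p.map (𝟙 d'.unop) ≫ x.1.1 = x.1.1
      simp
    · exact Category.id_comp x.1.2
  map_comp k k' := by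
    ext x
    · change p.map (k'.unop ≫ k.unop) ≫ x.1.1 = p.map k'.unop ≫ p.map k.unop ≫ x.1.1
      simp
    · exact Category.assoc k'.unop k.unop x.1.2

variable [IsSmallGenerated J] [IsSmallGenerated K] [p.IsCocontinuous K J]

/-- A morphism from the presheaf of factorizations of `f` to a sheaf `Q` is a local isomorphism as
soon as the elements of `Q` are pairs of an element of a sheaf `E ≅ l(d)` and an element of
`F ∘ p`, with `F ≅ l(c)`, that agree in `l(p d)`. -/
theorem W_of_isUniversalElement {c : C} {d : D} {f : c ⟶ p.obj d} {E Q : Sheaf K (Type w)}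
    {F G : Sheaf J (Type w)} {u : E.obj.obj (op d)} (hu : IsUniversalElement u)
    {x : F.obj.obj (op c)} (hx : IsUniversalElement x) {y : G.obj.obj (op (p.obj d))}
    (hy : IsUniversalElement y)
    (fst : Q ⟶ E) (snd : Q ⟶ (p.sheafPushforwardContinuous (Type w) K J).obj F)
    (hext : ∀ ⦃d' : D⦄ (q q' : Q.obj.obj (op d')),
      fst.hom.app _ q = fst.hom.app _ q' → snd.hom.app _ q = snd.hom.app _ q' → q = q')
    (hagree : ∀ ⦃d' : D⦄ (q : Q.obj.obj (op d')) (v : p.obj d' ⟶ c) (g : d' ⟶ d),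
      fst.hom.app _ q = E.obj.map g.op u → snd.hom.app (op d') q = F.obj.map v.op x →
      G.obj.map (v ≫ f).op y = G.obj.map (p.map g).op y)
    (ψ : factPresheaf p f ⟶ Q.obj)
    (hfst : ∀ ⦃d' : D⦄ (z : (factPresheaf p f).obj (op d')),
      fst.hom.app _ (ψ.app _ z) = E.obj.map z.1.2.op u)
    (hsnd : ∀ ⦃d' : D⦄ (z : (factPresheaf p f).obj (op d')),
      snd.hom.app (op d') (ψ.app _ z) = F.obj.map z.1.1.op x) :
    K.W ψ := by
  rw [GrothendieckTopology.W_iff_isLocallyBijective]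
  constructor
  · constructor
    rintro ⟨d'⟩ z z' h
    obtain ⟨S, hS, hS'⟩ := hu.exists_comp_eq_mem z.1.2 z'.1.2 (by rw [← hfst z, ← hfst z', h])
    obtain ⟨T, hT, hT'⟩ := hx.exists_comp_eq_mem z.1.1 z'.1.1 (by rw [← hsnd z, ← hsnd z', h])
    -- The components in `d` agree on a `K`-cover, those in `c` on a `J`-cover of `p d'`, which the
    -- comorphism property lifts to a `K`-cover of `d'`.
    refine K.superset_covering ?_ (K.intersection_covering hS (p.cover_lift K J hT))
    rintro d'' k ⟨hk₁, hk₂⟩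
    exact Subtype.ext (Prod.ext (hT' _ hk₂) (hS' _ hk₁))
  · constructor
    intro d' q
    obtain ⟨S, hS, hS'⟩ := hu.exists_map_eq_mem (fst.hom.app _ q)
    obtain ⟨T, hT, hT'⟩ := hx.exists_map_eq_mem (b := p.obj d') (snd.hom.app _ q)
    refine K.transitive (K.intersection_covering hS (p.cover_lift K J hT)) _ ?_
    rintro d'' k ⟨hk₁, hk₂⟩
    obtain ⟨g, hg⟩ := hS' _ hk₁
    obtain ⟨v, hv⟩ := hT' _ hk₂
    have hg' : fst.hom.app _ (Q.obj.map k.op q) = E.obj.map g.op u :=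
      (NatTrans.naturality_apply fst.hom k.op q).trans hg.symm
    have hv' : snd.hom.app (op d'') (Q.obj.map k.op q) = F.obj.map v.op x :=
      (NatTrans.naturality_apply snd.hom k.op q).trans hv.symm
    -- The arrows `v ≫ f` and `p g` agree only in the sheaf `G`, so a further cover is needed to
    -- make `(v, g)` a factorization.
    obtain ⟨U, hU, hU'⟩ := hy.exists_comp_eq_mem _ _ (hagree _ v g hg' hv')
    refine K.superset_covering ?_ (p.cover_lift K J hU)
    intro d₃ r hr
    have hz : (p.map r ≫ v) ≫ f = p.map (r ≫ g) := by
      rw [Category.assoc, p.map_comp]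
      exact hU' _ hr
    refine ⟨⟨⟨p.map r ≫ v, r ≫ g⟩, hz⟩, hext _ _ ((hfst _).trans ?_) ((hsnd _).trans ?_)⟩
    · rw [op_comp, op_comp, Functor.map_comp_apply, Functor.map_comp_apply, ← hg',
        NatTrans.naturality_apply fst.hom r.op]
    · rw [op_comp, op_comp, Functor.map_comp_apply, Functor.map_comp_apply, ← hv']
      exact (NatTrans.naturality_apply snd.hom r.op (Q.obj.map k.op q)).symm

include adj in
/-- If the left adjoint `L` of the composition with `p` is a Street fibration, the functors
`π_d^f` are `J`-cofinal. -/
theorem isCofinal_of_isStreetFibration (hL : IsStreetFibration L) {c : C} {d : D}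
    (f : c ⟶ p.obj d) : IsCofinal J (factProjection p f) := by
  let E := (canonicalFunctor K).obj d
  let u : E.obj.obj (op d) := canonicalHomEquiv K d E (𝟙 E)
  have hu : IsUniversalElement u := isUniversalElement_canonicalHomEquiv _
  -- This element names the arrow `l(f)` under `L (l d) ≅ l(p d)`.
  let x₀ : (L.obj E).obj.obj (op c) := (L.obj E).obj.map f.op (unitApp adj u)
  obtain ⟨Q, φ, σ, hσ, hφ⟩ := hL ((canonicalHomEquiv J c (L.obj E)).symm x₀)
  rw [isStronglyCartesian_iff_isPullback adj] at hφ
  let x : (L.obj Q).obj.obj (op c) := canonicalHomEquiv J c _ σ.inv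
  have hx : IsUniversalElement x := isUniversalElement_canonicalHomEquiv _
  have hx₀ : (L.map φ).hom.app _ x = x₀ := by
    rw [← canonicalHomEquiv_comp, hσ, Iso.inv_hom_id_assoc, Equiv.apply_symm_apply]
  have hw {d' : D} {v : p.obj d' ⟶ c} {g : d' ⟶ d} (h : v ≫ f = p.map g) :
      unitApp adj (E.obj.map g.op u) = (L.map φ).hom.app _ ((L.obj Q).obj.map v.op x) := by
    rw [unitApp_map, NatTrans.naturality_apply, hx₀, ← h]
    simp [x₀]
  have hext ⦃d' : D⦄ (q q' : Q.obj.obj (op d')) (h₁ : φ.hom.app _ q = φ.hom.app _ q')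
      (h₂ : unitApp adj q = unitApp adj q') : q = q' :=
    Types.ext_of_isPullback (isPullback_app hφ d') h₁ h₂
  have hex {d' : D} {v : p.obj d' ⟶ c} {g : d' ⟶ d} (h : v ≫ f = p.map g) :
      ∃ q : Q.obj.obj (op d'), φ.hom.app _ q = E.obj.map g.op u ∧
        unitApp adj q = (L.obj Q).obj.map v.op x :=
    Types.exists_of_isPullback (isPullback_app hφ d') _ _ (hw h)
  choose q hq₁ hq₂ using @hex
  let ψ : factPresheaf p f ⟶ Q.obj :=
    { app d' := TypeCat.ofHom fun z => q z.2
      naturality d' d'' k := by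
        ext z
        refine hext (d' := d''.unop) _ _ ((hq₁ _).trans ?_) ((hq₂ _).trans ?_)
        · refine Eq.trans ?_ ((congrArg (E.obj.map k) (hq₁ z.2)).symm.trans
            (NatTrans.naturality_apply φ.hom k _).symm)
          exact Functor.map_comp_apply E.obj z.1.2.op k u
        · refine Eq.trans ?_ ((congrArg ((L.obj Q).obj.map (p.map k.unop).op) (hq₂ z.2)).symm.trans
            (unitApp_map adj k.unop _).symm)
          exact Functor.map_comp_apply (L.obj Q).obj z.1.1.op (p.map k.unop).op x }
  have hψ : K.W ψ := by
    refine W_of_isUniversalElement hu hx (hu.unitApp adj) φ (adj.unit.app Q) hext ?_ ψ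
      (fun d' z => hq₁ z.2) (fun d' z => hq₂ z.2)
    intro d' q v g h₁ h₂
    have h₃ : unitApp adj q = (L.obj Q).obj.map v.op x := h₂
    rw [← unitApp_map, ← h₁, unitApp_naturality, h₃, NatTrans.naturality_apply, hx₀, op_comp,
      Functor.map_comp_apply]
  rw [isCofinal_iff]
  intro F a ha
  -- A compatible family over the factorization category is a morphism from the presheaf of
  -- factorizations to `F ∘ p`; as `ψ` is a local isomorphism, it extends uniquely to `Q`, hence to
  -- `L Q ⟶ F`.
  let α : factPresheaf p f ⟶ ((p.sheafPushforwardContinuous (Type w) K J).obj F).obj :=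
    { app d' := TypeCat.ofHom fun z => a ⟨d'.unop, z.1.1, z.1.2, z.2⟩
      naturality d' d'' k := by
        ext z
        let X : Fact p f := ⟨d'.unop, z.1.1, z.1.2, z.2⟩
        let Y : Fact p f := ⟨d''.unop, p.map k.unop ≫ z.1.1, k.unop ≫ z.1.2,
          ((factPresheaf p f).map k z).2⟩
        let t : Y ⟶ X := ⟨k.unop, rfl, rfl⟩
        exact (ha t).symm }
  have hα (b : L.obj Q ⟶ F) : ψ ≫ (adj.homEquiv _ _ b).hom = α ↔
      ∀ X : Fact p f, F.obj.map X.v.op (b.hom.app _ x) = a X := by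
    have h (d' : D) (z : (factPresheaf p f).obj (op d')) :
        (adj.homEquiv _ _ b).hom.app (op d') (ψ.app _ z) =
          F.obj.map z.1.1.op (b.hom.app _ x) := by
      rw [homEquiv_app, ← NatTrans.naturality_apply]
      exact congrArg _ (hq₂ z.2)
    constructor
    · intro h' X
      refine (h X.obj ⟨⟨X.v, X.g⟩, X.w⟩).symm.trans ?_
      exact congrArg (fun χ => χ.app (op X.obj) ⟨⟨X.v, X.g⟩, X.w⟩) h'
    · intro h'
      ext d' z
      exact (h d'.unop z).trans (h' ⟨d'.unop, z.1.1, z.1.2, z.2⟩)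
  let R := p.sheafPushforwardContinuous (Type w) K J
  have hbij : Function.Bijective fun b : L.obj Q ⟶ F => ψ ≫ (adj.homEquiv _ _ b).hom :=
    (hψ _ (R.obj F).property).comp
      ((fullyFaithfulSheafToPresheaf K (Type w)).homEquiv.bijective.comp
        (adj.homEquiv Q F).bijective)
  obtain ⟨b, hb, hb'⟩ := hbij.existsUnique α
  refine ⟨b.hom.app _ x, (hα b).1 hb, fun y hy => ?_⟩
  -- Universality of `x` presents any competing element as the image of `x` under an arrow `L Q ⟶
  -- F`.
  obtain ⟨b', rfl⟩ := (hx F).2 y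
  rw [← hb' b' ((hα b').2 hy)]

end Cofinal

end RelTopos

theorem proposition5p3p5 {C : Type u₁} [Category.{w} C] {D : Type u₂} [Category.{w} D]
    (J : GrothendieckTopology C) (K : GrothendieckTopology D)
    [RelTopos.IsSmallGenerated J] [RelTopos.IsSmallGenerated K]
    (p : D ⥤ C) [p.IsContinuous K J] [p.IsCocontinuous K J] :
    Nonempty (RelTopos.shStar p K J ⊣ RelTopos.comorphismInverseImage p K J) ∧
    (RelTopos.IsStreetFibration (RelTopos.shStar p K J) ↔
      ∀ (c : C) (d : D) (f : c ⟶ p.obj d),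
        RelTopos.IsCofinal J (RelTopos.factProjection p f)) :=
  ⟨⟨RelTopos.shStarAdjunction J K p⟩,
    fun h _ _ f => RelTopos.isCofinal_of_isStreetFibration
      (p.sheafAdjunctionContinuous (Type w) K J) h f,
    RelTopos.isStreetFibration_of_isCofinal (p.sheafAdjunctionContinuous (Type w) K J)⟩
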